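/- Let $K$ be a number field with absolute discriminant $\mathcal{D}_K\in\mathbb{Z}$, let $\bar K$ be an algebraic closure of $K$, and for a positive integer $m$ let $\zeta_m\in\bar K$ denote a primitive $m$-th root of unity. For a positive integer $\Lambda$, consider the following property: (P) for every positive integer $n$ and every $\alpha\in K$, if $\alpha=\beta^{\Lambda n}$ for some $\beta\in K(\zeta_{\Lambda n})$, then $\alpha=\gamma^{n}$ for some $\gamma\in K$. Then (P) holds with $\Lambda=64\,|\mathcal{D}_K|$. If moreover $K$ contains a square root $i$ of $-1$, then (P) holds with $\Lambda=2\,|\mathcal{D}_K|$. -/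

import Mathlib

/-- The Chevalley–Bass property of a field `K` with the constant `Λ`: the constant is a positive
integer and, for every positive integer `n`, if `α ∈ K` is a `Λn`-th power in the subfield
`K(ζ_{Λn})` of the algebraic closure of `K`, then `α` is an `n`-th power in `K`. -/
def ChevalleyBassHoldsWith (K : Type*) [Field K] (Λ : ℕ) : Prop :=
  0 < Λ ∧ ∀ n : ℕ, 0 < n →
    ∀ ζ : AlgebraicClosure K, IsPrimitiveRoot ζ (Λ * n) →
      ∀ α : K,
        (∃ β ∈ IntermediateField.adjoin K {ζ},
          β ^ (Λ * n) = algebraMap K (AlgebraicClosure K) α) →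
        ∃ γ : K, γ ^ n = α

/-! Being an `n`-th power can be tested prime by prime. Fix `p ∣ n`, write `Λn = p ^ k * m` with `p
∤ m`, let `v` be the valuation of `Λ` at `p`, and put `L = K(ζ_{Λn})`, which is abelian over `K`.

Suppose `σ ∈ Gal(L/K)` fixes `ζ_m` and raises `ζ_{p^k}` to a power `a` with `p ^ (v + 1) ∤ a - 1`.
Since `σ` is central, `a - 1` essentially annihilates the Kummer cocycle of a `p ^ k`-th root of
`α`: after a twist by a root of unity that root is fixed by `σ`, and its `p ^ v`-th power then lies
in `K` (`exists_pow_prime_pow_sub_eq_of_central`).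

Such a `σ` comes from inertia above `p` (`exists_mem_inertia_not_dvd_sub_one`). If `e` is the
ramification index in `K`, inertia in `L/K` has order at least `φ(p ^ k) / e` and embeds in `(ℤ/p ^
k)ˣ`; were it trivial modulo `p ^ (v + 1)`, then `φ(p ^ (v + 1)) ≤ e`. But `p ^ (e - 1)` divides the
discriminant, which makes `e` too small. For `p = 2` one also needs `a ≡ 1` modulo `4`: automatic if
`i ∈ K`, and otherwise obtained at the cost of a factor `c = 2`. -/

open NumberField

/-! ### Ramification and inertia above `p` -/

/-- A prime of ramification index `e` above `p` contributes `p ^ (e - 1)` to the discriminant. -/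
theorem pow_ramificationIdx_sub_one_dvd_discr (K : Type*) [Field K] [NumberField K] {p : ℕ}
    (hp : p.Prime) (P : Ideal (𝓞 K)) [P.IsPrime] [P.LiesOver (Ideal.span {(p : ℤ)})] :
    p ^ (P.ramificationIdx ℤ - 1) ∣ (discr K).natAbs := by
  have hp0 : (Ideal.span {(p : ℤ)}) ≠ ⊥ := by simpa using hp.ne_zero
  have hpZ : Prime (p : ℤ) := Nat.prime_iff_prime_int.mp hp
  have : (Ideal.span {(p : ℤ)}).IsPrime := (Ideal.span_singleton_prime hpZ.ne_zero).2 hpZ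
  have : (Ideal.span {(p : ℤ)}).IsMaximal := this.isMaximal hp0
  have hdvd : P ^ P.ramificationIdx ℤ ∣ (Ideal.span {(p : ℤ)}).map (algebraMap ℤ (𝓞 K)) := by
    rw [Ideal.IsDedekindDomain.ramificationIdx_eq_multiplicity (Ideal.span {(p : ℤ)}) P
      (Ideal.map_ne_bot_of_ne_bot hp0)]
    exact pow_multiplicity_dvd _ _
  -- `P ^ (e - 1)` divides the different, whose norm is the absolute discriminant; the norm of `P`
  -- is a positive power of `p`.
  have h := Ideal.absNorm_dvd_absNorm_of_le (Ideal.dvd_iff_le.mp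
    (pow_sub_one_dvd_differentIdeal ℤ P _ hp0 hdvd))
  rw [map_pow, absNorm_differentIdeal K (𝓞 K)] at h
  refine (pow_dvd_pow_of_dvd ?_ _).trans h
  rw [Ideal.absNorm_eq_pow_inertiaDeg P hpZ, Int.natAbs_natCast]
  exact dvd_pow_self _ (Ideal.inertiaDeg'_pos _ _).ne'

/-- A number field containing the `p ^ k`-th roots of unity is ramified of index at least
`φ (p ^ k)` at every prime above `p`. -/
theorem totient_le_ramificationIdx (L : Type*) [Field L] [NumberField L] {p k : ℕ}
    (hp : p.Prime) (hk : k ≠ 0) {ζ : 𝓞 L} (hζ : IsPrimitiveRoot ζ (p ^ k))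
    (P : Ideal (𝓞 L)) [P.IsPrime] [P.LiesOver (Ideal.span {(p : ℤ)})] :
    (p ^ k).totient ≤ P.ramificationIdx ℤ := by
  have hp0 : (Ideal.span {(p : ℤ)}) ≠ ⊥ := by simpa using hp.ne_zero
  have hmap := Ideal.map_ne_bot_of_ne_bot (S := 𝓞 L) hp0
  obtain ⟨k, rfl⟩ := Nat.exists_eq_succ_of_ne_zero hk
  -- This is `Φ_{p^(k+1)}(1) = p`; the factors `1 - μ` are all associated, so `p` is a unit times a
  -- `φ(p ^ (k + 1))`-th power.
  have hprod : (p : 𝓞 L) = ∏ μ ∈ primitiveRoots (p ^ (k + 1)) (𝓞 L), (1 - μ) := by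
    have := Fact.mk hp
    rw [← Polynomial.eval_one_cyclotomic_prime_pow (R := 𝓞 L) k (p := p),
      Polynomial.cyclotomic_eq_prod_X_sub_primitiveRoots hζ, Polynomial.eval_prod]
    simp
  have hassoc : Associated ((1 - ζ) ^ (p ^ (k + 1)).totient) (p : 𝓞 L) := by
    rw [hprod, ← hζ.card_primitiveRoots, ← Finset.prod_const]
    refine Associated.prod _ _ _ fun μ hμ => ?_
    have : NeZero (p ^ (k + 1)) := ⟨(pow_pos hp.pos _).ne'⟩
    rw [mem_primitiveRoots (pow_pos hp.pos _)] at hμ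
    obtain ⟨i, -, hi, rfl⟩ := (hζ.isPrimitiveRoot_iff ).1 hμ
    rw [← neg_sub ζ, ← neg_sub (ζ ^ i)]
    exact (hζ.associated_sub_one_pow_sub_one_of_coprime hi).neg_neg
  have hpP : (p : 𝓞 L) ∈ P := by
    have : (p : ℤ) ∈ P.under ℤ := by
      rw [← Ideal.over_def P (Ideal.span {(p : ℤ)})]
      exact Ideal.mem_span_singleton_self _
    simpa using this
  have hζP : 1 - ζ ∈ P :=
    Ideal.IsPrime.mem_of_pow_mem ‹_› _ ((P.mem_iff_of_associated hassoc).2 hpP)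
  rw [Ideal.IsDedekindDomain.ramificationIdx_eq_multiplicity (Ideal.span {(p : ℤ)}) P hmap]
  refine FiniteMultiplicity.le_multiplicity_of_pow_dvd ?_ ?_
  · refine FiniteMultiplicity.of_not_isUnit ?_ hmap
    rw [Ideal.isUnit_iff]
    exact Ideal.IsPrime.ne_top ‹_›
  · rw [Ideal.map_span, Set.image_singleton, Ideal.dvd_span_singleton]
    refine (Ideal.mem_iff_of_associated ?_).1 (Ideal.pow_mem_pow hζP _)
    simpa using hassoc

/-- Elements of the inertia group of a prime above `p` fix the roots of unity of order prime
to `p`. -/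
theorem inertia_smul_eq_of_pow_eq_one {R G : Type*} [CommRing R] [IsDomain R] [Group G]
    [MulSemiringAction G R] {P : Ideal R} [hP : P.IsPrime] {p m : ℕ} (hpP : (p : R) ∈ P)
    (hm : p.Coprime m) {σ : G} (hσ : σ ∈ P.inertia G) {ξ : R} (hξ : ξ ^ m = 1) :
    σ • ξ = ξ := by
  rcases Nat.eq_zero_or_pos m with rfl | hm0
  · rw [Nat.coprime_zero_right] at hm
    subst hm
    exact absurd (P.eq_top_of_isUnit_mem (by simpa using hpP) isUnit_one) hP.ne_top
  have hξu : ξ * ξ ^ (m - 1) = 1 := by rw [← pow_succ', Nat.sub_add_cancel hm0, hξ]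
  -- `η` is `σξ / ξ`, an `m`-th root of unity congruent to `1` modulo `P`. If `η ≠ 1`, then `1 + η +
  -- ⋯ + η ^ (m - 1) = 0` reduces to `m ∈ P`, impossible as `p ∈ P`.
  set η := σ • ξ * ξ ^ (m - 1) with hη
  have hηm : η ^ m = 1 := by
    rw [hη, mul_pow, ← smul_pow', hξ, smul_one, ← pow_mul, mul_comm (m - 1), pow_mul, hξ]
    simp
  have hη1 : η - 1 ∈ P := by
    have : η - 1 = (σ • ξ - ξ) * ξ ^ (m - 1) := by rw [sub_mul, hξu]
    rw [this]
    exact P.mul_mem_right _ (hσ ξ)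
  have hgeom : (∑ i ∈ Finset.range m, η ^ i) * (η - 1) = 0 := by
    rw [geom_sum_mul, hηm, sub_self]
  rcases mul_eq_zero.1 hgeom with h | h
  · exfalso
    have hmk : Ideal.Quotient.mk P η = 1 := by
      rw [← map_one (Ideal.Quotient.mk P)]
      exact Ideal.Quotient.eq.2 hη1
    have hmP : (m : R) ∈ P := by
      apply Ideal.Quotient.eq_zero_iff_mem.1
      have := congrArg (Ideal.Quotient.mk P) h
      simpa [hmk] using this
    obtain ⟨a, b, hab⟩ := Nat.isCoprime_iff_coprime.2 hm
    apply hP.ne_top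
    rw [Ideal.eq_top_iff_one]
    have h1 : (a : R) * p + b * m = 1 := by exact_mod_cast congrArg (Int.cast : ℤ → R) hab
    rw [← h1]
    exact P.add_mem (P.mul_mem_left _ hpP) (P.mul_mem_left _ hmP)
  · have := congrArg (· * ξ) (sub_eq_zero.1 h)
    simpa [hη, mul_assoc, mul_comm (ξ ^ (m - 1)) ξ, hξu] using this

/-- In a Galois extension `L / K` of number fields whose top contains the `p ^ k`-th roots of
unity, the inertia groups above `p` have order at least `φ (p ^ k) / e`, with `e` the ramification
index in `K`. -/
theorem totient_le_ramificationIdx_mul_card_inertia (K L : Type*) [Field K] [NumberField K]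
    [Field L] [NumberField L] [Algebra K L] [IsGalois K L] {p k : ℕ} (hp : p.Prime) (hk : k ≠ 0)
    {ζ : 𝓞 L} (hζ : IsPrimitiveRoot ζ (p ^ k)) (P : Ideal (𝓞 L)) [P.IsPrime]
    [P.LiesOver (Ideal.span {(p : ℤ)})] :
    (p ^ k).totient ≤ (P.under (𝓞 K)).ramificationIdx ℤ * Nat.card (P.inertia Gal(L/K)) := by
  rw [Ideal.card_inertia_eq_ramificationIdxIn (P.under (𝓞 K)) P,
    Ideal.ramificationIdxIn_eq_ramificationIdx (P.under (𝓞 K)) P Gal(L/K),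
    ← Ideal.ramificationIdx_tower]
  exact totient_le_ramificationIdx L hp hk hζ P

/-! ### Kummer descent by a central automorphism -/

/-- Lifting the exponent for an integer `a ≡ 1` modulo `p`, and modulo `4` if `p = 2`. -/
theorem emultiplicity_pow_prime_pow_sub_one {p : ℕ} (hp : p.Prime) {a u : ℤ} {b : ℕ} (hb : b ≠ 0)
    (ha : a - 1 = (p : ℤ) ^ b * u) (hu : ¬ (p : ℤ) ∣ u) (h4 : p = 2 → 4 ∣ a - 1) (r : ℕ) :
    emultiplicity (p : ℤ) (a ^ p ^ r - 1) = (b + r : ℕ) := by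
  have hpZ : Prime (p : ℤ) := Nat.prime_iff_prime_int.mp hp
  have hpa1 : (p : ℤ) ∣ a - 1 := ha ▸ (dvd_pow_self _ hb).mul_right _
  have hpa : ¬ (p : ℤ) ∣ a := fun h => hpZ.not_dvd_one (by simpa using dvd_sub h hpa1)
  have hba : emultiplicity (p : ℤ) (a - 1) = b :=
    emultiplicity_eq_coe.2 ⟨⟨u, ha⟩, fun h => hu <| by
      rw [ha, pow_succ] at h
      exact Int.dvd_of_mul_dvd_mul_left (pow_ne_zero _ hpZ.ne_zero) h⟩
  have hr : emultiplicity (p : ℤ) ((p ^ r : ℕ) : ℤ) = r := by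
    push_cast
    exact emultiplicity_pow_self_of_prime hpZ r
  rcases hp.eq_two_or_odd' with rfl | hodd
  · have := Int.two_pow_sub_pow' (x := a) (y := 1) (2 ^ r) (h4 rfl) (by simpa using hpa)
    rw [one_pow] at this
    push_cast at this hba hr ⊢
    rw [this, hba, hr]
  · have := Int.emultiplicity_pow_sub_pow hp hodd hpa1 hpa (p ^ r)
    rw [one_pow] at this
    rw [this, hba, ← Int.natCast_emultiplicity, hr]
    push_cast
    rfl

/-- The factor `u` is invertible modulo `p ^ k`. The solution `d` is the exponent of the twist that
makes a radical fixed by `σ`. -/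
theorem exists_prime_pow_dvd_mul_sub_one_sub {p : ℕ} (hp : p.Prime) {a t u : ℤ} {b k : ℕ}
    (ha : a - 1 = (p : ℤ) ^ b * u) (hu : ¬ (p : ℤ) ∣ u) (ht : (p : ℤ) ^ b ∣ t) :
    ∃ d : ℤ, (p : ℤ) ^ k ∣ d * (a - 1) - t := by
  obtain ⟨t', rfl⟩ := ht
  have hpZ : Prime (p : ℤ) := Nat.prime_iff_prime_int.mp hp
  obtain ⟨x, y, hxy⟩ : IsCoprime ((p : ℤ) ^ k) u :=
    ((Prime.coprime_iff_not_dvd hpZ).2 hu).pow_left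
  refine ⟨y * t', -((p : ℤ) ^ b * t' * x), ?_⟩
  rw [ha]
  linear_combination (p : ℤ) ^ b * t' * hxy

/-- If `σ` is a central element of a Galois group acting on the `p ^ k`-th roots of unity through
the exponent `a` with `p ^ (v + 1) ∤ a - 1`, then elements of the base field that become
`p ^ k`-th powers are `p ^ (k - v)`-th powers. -/
theorem exists_pow_prime_pow_sub_eq_of_central {K L : Type*} [Field K] [Field L] [Algebra K L]
    [FiniteDimensional K L] [IsGalois K L] {p k v : ℕ} (hp : p.Prime) (hvk : v ≤ k) {ζ : L}
    (hζ : IsPrimitiveRoot ζ (p ^ k)) (σ : Gal(L/K)) (hcomm : ∀ τ, σ * τ = τ * σ) {a : ℤ}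
    (ha : σ ζ = ζ ^ a) (hav : ¬ (p : ℤ) ^ (v + 1) ∣ a - 1) (h4 : p = 2 → 4 ∣ a - 1)
    (hord : ∀ m, (σ ^ m) ζ = ζ → σ ^ m = 1) {α : K} {β : L}
    (hβ : β ^ p ^ k = algebraMap K L α) : ∃ γ : K, γ ^ p ^ (k - v) = α := by
  have hpZ : Prime (p : ℤ) := Nat.prime_iff_prime_int.mp hp
  have hpk : p ^ k ≠ 0 := pow_ne_zero _ hp.ne_zero
  have hζ0 : ζ ≠ 0 := hζ.ne_zero hpk
  have : NeZero (p ^ k) := ⟨hpk⟩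
  rcases eq_or_ne β 0 with rfl | hβ0
  · refine ⟨0, ?_⟩
    rw [zero_pow hpk, eq_comm, map_eq_zero] at hβ
    rw [zero_pow (pow_ne_zero _ hp.ne_zero), hβ]
  have hone : ∀ e : ℤ, ζ ^ e = 1 ↔ (p : ℤ) ^ k ∣ e := fun e => by
    rw [hζ.zpow_eq_one_iff_dvd]; push_cast; rfl
  have hroot : ∀ (τ : Gal(L/K)) (x : L), x ≠ 0 → x ^ p ^ k = algebraMap K L α →
      ∃ t : ℤ, τ x = x * ζ ^ t := by
    intro τ x hx0 hx
    have h1 : (τ x / x) ^ p ^ k = 1 := by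
      rw [div_pow, ← map_pow, hx, τ.commutes, div_self]
      rw [← hx]
      exact pow_ne_zero _ hx0
    obtain ⟨t, -, ht⟩ := hζ.eq_pow_of_pow_eq_one h1
    exact ⟨t, by rw [zpow_natCast, ht, mul_div_cancel₀ _ hx0]⟩
  obtain ⟨b, u, hu, hab⟩ : ∃ b u, ¬ (p : ℤ) ∣ u ∧ a - 1 = (p : ℤ) ^ b * u := by
    have hfin : FiniteMultiplicity (p : ℤ) (a - 1) :=
      ⟨v, hav⟩
    obtain ⟨u, h1, h2⟩ := hfin.exists_eq_pow_mul_and_not_dvd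
    exact ⟨_, u, h2, h1⟩
  have hbv : b ≤ v := by
    by_contra! h
    exact hav (hab ▸ (pow_dvd_pow _ h).mul_right _)
  obtain ⟨t, ht⟩ := hroot σ β hβ0 hβ
  -- For `b ≠ 0`, lifting the exponent gives `σ ^ p ^ (k - b) = 1`. Applied to `β`, this yields `p ^
  -- k ∣ t * S` with `S` the geometric sum in `a`, whose valuation is exactly `k - b`.
  have htb : (p : ℤ) ^ b ∣ t := by
    rcases eq_or_ne b 0 with rfl | hb
    · simp
    have hσζ : ∀ m : ℕ, (σ ^ m) ζ = ζ ^ (a ^ m) := by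
      intro m
      induction m with
      | zero => simp
      | succ m ih => rw [pow_succ', AlgEquiv.mul_apply, ih, map_zpow₀, ha, ← zpow_mul, pow_succ']
    have hσβ : ∀ m : ℕ, (σ ^ m) β = β * ζ ^ (t * ∑ i ∈ Finset.range m, a ^ i) := by
      intro m
      induction m with
      | zero => simp
      | succ m ih =>
        rw [pow_succ', AlgEquiv.mul_apply, ih, map_mul, map_zpow₀, ha, ht, ← zpow_mul, mul_assoc,
          ← zpow_add₀ hζ0, geom_sum_succ]
        congr 2
        ring
    have hmul := emultiplicity_pow_prime_pow_sub_one hp hb hab hu h4 (k - b)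
    rw [Nat.add_sub_cancel' (hbv.trans hvk), emultiplicity_eq_coe] at hmul
    obtain ⟨⟨w, hw⟩, hnot⟩ := hmul
    have hpw : ¬ (p : ℤ) ∣ w := fun h => hnot (by
      rw [hw, pow_succ]; exact mul_dvd_mul_left _ h)
    have h1 : σ ^ p ^ (k - b) = 1 := by
      apply hord
      rw [hσζ, ← sub_add_cancel (a ^ p ^ (k - b)) 1, zpow_add_one₀ hζ0, (hone _).2 ⟨w, hw⟩,
        one_mul]
    have h2 := hσβ (p ^ (k - b))
    rw [h1, AlgEquiv.one_apply, eq_comm, mul_eq_left₀ hβ0, hone] at h2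
    have h3 : (p : ℤ) ^ k ∣ (p : ℤ) ^ (k - b) * (t * w) := by
      have hS := geom_sum_mul a (p ^ (k - b))
      rw [hw, hab, ← Nat.sub_add_cancel (hbv.trans hvk), pow_add, Nat.add_sub_cancel] at hS
      have hS' : (∑ i ∈ Finset.range (p ^ (k - b)), a ^ i) * u = (p : ℤ) ^ (k - b) * w := by
        apply mul_left_cancel₀ (pow_ne_zero b hpZ.ne_zero)
        linear_combination hS
      have : (p : ℤ) ^ (k - b) * (t * w) =
          t * (∑ i ∈ Finset.range (p ^ (k - b)), a ^ i) * u := by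
        linear_combination -t * hS'
      rw [this]
      exact h2.mul_right _
    rw [← Nat.sub_add_cancel (hbv.trans hvk), pow_add, Nat.add_sub_cancel] at h3
    exact hpZ.pow_dvd_of_dvd_mul_right b hpw
      (Int.dvd_of_mul_dvd_mul_left (pow_ne_zero _ hpZ.ne_zero) h3)
  obtain ⟨d, hd⟩ := exists_prime_pow_dvd_mul_sub_one_sub (k := k) hp hab hu htb
  -- Here `σ x = x * ζ ^ (t - d * (a - 1)) = x`.
  set x := β * ζ ^ (-d) with hx
  have hx0 : x ≠ 0 := mul_ne_zero hβ0 (zpow_ne_zero _ hζ0)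
  have hxα : x ^ p ^ k = algebraMap K L α := by
    rw [hx, mul_pow, hβ, ← zpow_natCast (ζ ^ (-d)), ← zpow_mul, (hone _).2, mul_one]
    push_cast
    exact dvd_mul_left _ _
  have hσx : σ x = x := by
    have : ζ ^ t * ζ ^ (a * -d) = ζ ^ (-d) := by
      rw [← zpow_add₀ hζ0, ← div_eq_one_iff_eq (zpow_ne_zero _ hζ0), ← zpow_sub₀ hζ0, hone,
        show t + a * -d - -d = -(d * (a - 1) - t) by ring, dvd_neg]
      exact hd
    rw [hx, map_mul, map_zpow₀, ha, ht, ← zpow_mul, mul_assoc, this]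
  -- Write `τ x = x * ζ ^ r`. By centrality `σ` fixes `τ x`, hence `ζ ^ r`, so `p ^ k ∣ r * (a - 1)`
  -- and `ζ ^ r` is killed by `p ^ v`.
  have hfix : ∀ τ : Gal(L/K), τ (x ^ p ^ v) = x ^ p ^ v := by
    intro τ
    obtain ⟨r, hr⟩ := hroot τ x hx0 hxα
    have h1 : σ (τ x) = τ x := by
      rw [← AlgEquiv.mul_apply, hcomm, AlgEquiv.mul_apply, hσx]
    rw [hr, map_mul, hσx, map_zpow₀, ha, ← zpow_mul] at h1
    have h2 := mul_left_cancel₀ hx0 h1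
    rw [← div_eq_one_iff_eq (zpow_ne_zero _ hζ0), ← zpow_sub₀ hζ0, hone] at h2
    have h3 : (p : ℤ) ^ k ∣ (r * (p : ℤ) ^ b) * u := by
      convert h2 using 1
      linear_combination -r * hab
    have h4 : (p : ℤ) ^ k ∣ r * (p : ℤ) ^ v :=
      (hpZ.pow_dvd_of_dvd_mul_right k hu h3).trans (mul_dvd_mul_left _ (pow_dvd_pow _ hbv))
    rw [map_pow, hr, mul_pow, ← zpow_natCast (ζ ^ r), ← zpow_mul, (hone _).2, mul_one]
    push_cast
    exact h4
  obtain ⟨γ, hγ⟩ := (IsGalois.mem_range_algebraMap_iff_fixed (F := K) (x ^ p ^ v)).2 hfix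
  refine ⟨γ, (algebraMap K L).injective ?_⟩
  rw [map_pow, hγ, ← pow_mul, ← pow_add, Nat.add_sub_cancel' hvk, hxα]

/-! ### Finding a suitable inertia element -/

theorem ZMod.unitsMap_eq_one_iff_dvd_val_sub_one {d n : ℕ} [NeZero n] (h : d ∣ n) (x : (ZMod n)ˣ) :
    ZMod.unitsMap h x = 1 ↔ (d : ℤ) ∣ ((x : ZMod n).val : ℤ) - 1 := by
  rw [Units.ext_iff, ZMod.unitsMap_val, Units.val_one, ← ZMod.intCast_zmod_eq_zero_iff_dvd]
  push_cast
  rw [sub_eq_zero, ZMod.natCast_val]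

/-- A subgroup of `(ℤ / n)ˣ` of small enough index is not trivial modulo `d`. -/
theorem exists_unitsMap_ne_one_of_card {H : Type*} [Group H] [Finite H] {d n : ℕ} [NeZero n]
    (hdn : d ∣ n) (f : H →* (ZMod n)ˣ) (hf : Function.Injective f) (H' : Subgroup H) {e c : ℕ}
    (hcard : n.totient ≤ e * Nat.card H) (hH' : Nat.card H ≤ c * Nat.card H')
    (hlt : e * c < d.totient) : ∃ h ∈ H', ZMod.unitsMap hdn (f h) ≠ 1 := by
  by_contra! hcon
  have hd : NeZero d := ⟨fun h => NeZero.ne n (Nat.eq_zero_of_zero_dvd (h ▸ hdn))⟩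
  have hker : Nat.card (ZMod.unitsMap hdn).ker * d.totient = n.totient := by
    have h1 := (ZMod.unitsMap hdn).ker.card_mul_index
    rw [Subgroup.index_ker, MonoidHom.range_eq_top.2 (ZMod.unitsMap_surjective hdn)] at h1
    simpa [Nat.card_eq_fintype_card, ZMod.card_units_eq_totient] using h1
  -- Otherwise `H'` embeds in the kernel of reduction modulo `d`, of order `φ(n) / φ(d)`.
  have hle : Nat.card H' ≤ Nat.card (ZMod.unitsMap hdn).ker :=
    Nat.card_le_card_of_injective (fun h : H' => ⟨f h, hcon _ h.2⟩) fun x y hxy =>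
      Subtype.ext (hf (congrArg Subtype.val hxy))
  have hpos : 0 < Nat.card H' := Nat.card_pos
  have h1 : Nat.card H' * d.totient ≤ Nat.card H' * (e * c) :=
    calc Nat.card H' * d.totient ≤ n.totient := hker ▸ Nat.mul_le_mul_right _ hle
      _ ≤ e * Nat.card H := hcard
      _ ≤ e * (c * Nat.card H') := Nat.mul_le_mul_left _ hH'
      _ = Nat.card H' * (e * c) := by ring
  exact absurd (Nat.le_of_mul_le_mul_left h1 hpos) hlt.not_ge

theorem IsPrimitiveRoot.algEquiv_eq_one_of_apply_eq {K L : Type*} [Field K] [Field L] [Algebra K L]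
    {n : ℕ} [NeZero n] [IsCyclotomicExtension {n} K L] {μ : L} (hμ : IsPrimitiveRoot μ n)
    {σ : Gal(L/K)} (h : σ μ = μ) : σ = 1 := by
  refine AlgEquiv.coe_toAlgHom_injective ((hμ.powerBasis K).algHom_ext ?_)
  simpa [IsPrimitiveRoot.powerBasis_gen] using h

/-- If `i ∈ K`, then automorphisms over `K` act on the `2 ^ k`-th roots of unity, `k ≥ 2`, through
exponents congruent to `1` modulo `4`. -/
theorem four_dvd_sub_one_of_sq_eq_neg_one {K L : Type*} [Field K] [Field L] [Algebra K L] {k : ℕ}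
    (hk : 2 ≤ k) {ζ : L} (hζ : IsPrimitiveRoot ζ (2 ^ k)) (σ : Gal(L/K)) {a : ℕ}
    (ha : σ ζ = ζ ^ a) {i : K} (hi : i ^ 2 = -1) : (4 : ℤ) ∣ (a : ℤ) - 1 := by
  have h4 : IsPrimitiveRoot (ζ ^ 2 ^ (k - 2)) 4 := by
    refine hζ.pow (by positivity) ?_
    rw [show (4 : ℕ) = 2 ^ 2 by norm_num, ← pow_add, Nat.sub_add_cancel hk]
  set ω := ζ ^ 2 ^ (k - 2) with hω
  have hω2 : ω ^ 2 = (algebraMap K L i) ^ 2 := by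
    have h2 : IsPrimitiveRoot (ω ^ 2) 2 := h4.pow (by norm_num) (by norm_num)
    rw [h2.eq_neg_one_of_two_right, ← map_pow, hi, map_neg, map_one]
  have hfix : σ ω = ω := by
    rcases sq_eq_sq_iff_eq_or_eq_neg.1 hω2 with h | h <;> simp [h]
  have hpow : ω ^ ((a : ℤ) - 1) = 1 := by
    have h0 : ω ≠ 0 := h4.ne_zero (by norm_num)
    rw [zpow_sub_one₀ h0, zpow_natCast, mul_inv_eq_one₀ h0]
    rw [hω, map_pow, ha] at hfix
    rw [hω, ← pow_mul, mul_comm, pow_mul, hfix]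
  exact_mod_cast (h4.zpow_eq_one_iff_dvd _).1 hpow

/-- The inertia group above `p` of the `p ^ k * m`-th cyclotomic extension of `K`, with `p ∤ m`,
contains an automorphism that acts on the `p ^ k`-th roots of unity through an exponent which is
not congruent to `1` modulo `p ^ (v + 1)`, provided that `v` is large compared to the valuation of
the discriminant of `K` at `p`. -/
theorem exists_mem_inertia_not_dvd_sub_one (K L : Type*) [Field K] [NumberField K] [Field L]
    [NumberField L] [Algebra K L] {p k m v c : ℕ} [NeZero (p ^ k * m)]
    [IsCyclotomicExtension {p ^ k * m} K L] [IsGalois K L] (hp : p.Prime) (hpm : p.Coprime m)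
    (hvk : v < k) {ζ ξ : L} (hζ : IsPrimitiveRoot ζ (p ^ k)) (hξ : IsPrimitiveRoot ξ m)
    (hc : ∀ e, e ≠ 0 → p ^ (e - 1) ∣ (discr K).natAbs → e * c < (p ^ (v + 1)).totient)
    (hc0 : c ≠ 0) (hI : p = 2 → c = 2 ∨ ∃ i : K, i ^ 2 = -1) :
    ∃ σ : Gal(L/K), σ ξ = ξ ∧ ∃ a : ℕ, σ ζ = ζ ^ a ∧ ¬ (p : ℤ) ^ (v + 1) ∣ (a : ℤ) - 1 ∧
      (p = 2 → 4 ∣ (a : ℤ) - 1) := by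
  have : NeZero (p ^ k) := ⟨pow_ne_zero _ hp.ne_zero⟩
  have : Fact p.Prime := ⟨hp⟩
  have hpZ : Prime (p : ℤ) := Nat.prime_iff_prime_int.mp hp
  have : (Ideal.span {(p : ℤ)}).IsPrime := (Ideal.span_singleton_prime hpZ.ne_zero).2 hpZ
  obtain ⟨⟨P, _, _⟩⟩ := (inferInstance : Nonempty ((Ideal.span {(p : ℤ)}).primesOver (𝓞 L)))
  have hLO : (P.under (𝓞 K)).LiesOver (Ideal.span {(p : ℤ)}) :=
    Ideal.LiesOver.tower_bot P (P.under (𝓞 K)) _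
  have hpP : (p : 𝓞 L) ∈ P := by
    have : (p : ℤ) ∈ P.under ℤ := by
      rw [← Ideal.over_def P (Ideal.span {(p : ℤ)})]
      exact Ideal.mem_span_singleton_self _
    simpa using this
  have hk0 : k ≠ 0 := by lia
  have hcard := totient_le_ramificationIdx_mul_card_inertia K L hp hk0
    hζ.toInteger_isPrimitiveRoot P
  have hlt := hc _ (Ideal.ramificationIdx_pos (P.under (𝓞 K)) ℤ).ne'
    (pow_ramificationIdx_sub_one_dvd_discr K hp (P.under (𝓞 K)))
  set T := P.inertia Gal(L/K) with hT
  have hTξ : ∀ σ ∈ T, σ ξ = ξ := by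
    intro σ hσ
    have hm0 : NeZero m := ⟨fun h => NeZero.ne (p ^ k * m) (by simp [h])⟩
    have := inertia_smul_eq_of_pow_eq_one hpP hpm hσ hξ.toInteger_isPrimitiveRoot.pow_eq_one
    exact congrArg (algebraMap (𝓞 L) L) this
  have hcop : (p ^ k).Coprime m := hpm.pow_left k
  have hprod : IsPrimitiveRoot (ζ * ξ) (p ^ k * m) := by
    rw [IsPrimitiveRoot.iff_orderOf, (Commute.all ζ ξ).orderOf_mul_eq_mul_orderOf_of_coprime,
      ← hζ.eq_orderOf, ← hξ.eq_orderOf]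
    rwa [← hζ.eq_orderOf, ← hξ.eq_orderOf]
  let f : T →* (ZMod (p ^ k))ˣ := (hζ.autToPow K).comp T.subtype
  have hspec : ∀ σ : T, (σ : Gal(L/K)) ζ = ζ ^ ((f σ : ZMod (p ^ k)).val) :=
    fun σ => (hζ.autToPow_spec K _).symm
  have hf : Function.Injective f := by
    rw [injective_iff_map_eq_one]
    intro σ hσ
    have h1 : (σ : Gal(L/K)) ζ = ζ := by
      have h2 := hspec σ
      have h3 := (hζ.zpow_eq_one_iff_dvd (((f σ : ZMod (p ^ k)).val : ℤ) - 1)).2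
        ((ZMod.unitsMap_eq_one_iff_dvd_val_sub_one dvd_rfl _).1 (by rw [hσ, map_one]))
      have h0 := hζ.ne_zero (NeZero.ne (p ^ k))
      rw [zpow_sub_one₀ h0, zpow_natCast, mul_inv_eq_one₀ h0] at h3
      rw [h2, h3]
    refine Subtype.ext (hprod.algEquiv_eq_one_of_apply_eq ?_)
    rw [map_mul, h1, hTξ σ σ.2]
  have key : ∀ H' : Subgroup T, Nat.card T ≤ c * Nat.card H' →
      ∃ σ ∈ H', ¬ (p : ℤ) ^ (v + 1) ∣ ((f σ : ZMod (p ^ k)).val : ℤ) - 1 := by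
    intro H' hH'
    obtain ⟨σ, h1, h2⟩ := exists_unitsMap_ne_one_of_card (pow_dvd_pow p hvk) f hf H' hcard hH' hlt
    refine ⟨σ, h1, fun h => h2 ?_⟩
    rw [ZMod.unitsMap_eq_one_iff_dvd_val_sub_one]
    exact_mod_cast h
  suffices ∃ σ : T, ¬ (p : ℤ) ^ (v + 1) ∣ ((f σ : ZMod (p ^ k)).val : ℤ) - 1 ∧
      (p = 2 → 4 ∣ ((f σ : ZMod (p ^ k)).val : ℤ) - 1) by
    obtain ⟨σ, h1, h2⟩ := this
    exact ⟨σ, hTξ σ σ.2, _, hspec σ, h1, h2⟩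
  have hTop : Nat.card T ≤ c * Nat.card (⊤ : Subgroup T) := by
    rw [Subgroup.card_top]
    exact Nat.le_mul_of_pos_left _ (Nat.pos_of_ne_zero hc0)
  by_cases hp2 : p = 2
  · subst hp2
    -- The case `e = 1` of `hc` reads `c < φ(2 ^ (v + 1))`, which excludes `v = 0`.
    have hk2 : 2 ≤ k := by
      have h1 := hc 1 one_ne_zero (by simp)
      rcases v with - | v
      · simp at h1; lia
      · lia
    rcases hI rfl with rfl | ⟨i, hi⟩
    · have h4 : 4 ∣ 2 ^ k := pow_dvd_pow 2 hk2
      -- The kernel of the action modulo `4` has index at most `2`; this is what `c = 2` pays for.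
      let g : T →* (ZMod 4)ˣ := (ZMod.unitsMap h4).comp f
      have hg : Nat.card T ≤ 2 * Nat.card g.ker := by
        rw [← g.ker.card_mul_index, Subgroup.index_ker, mul_comm]
        refine Nat.mul_le_mul_right _ ((Subgroup.card_le_card_group _).trans ?_)
        rw [Nat.card_eq_fintype_card, ZMod.card_units_eq_totient]
        decide
      obtain ⟨σ, h1, h2⟩ := key g.ker hg
      refine ⟨σ, h2, fun _ => ?_⟩
      exact_mod_cast (ZMod.unitsMap_eq_one_iff_dvd_val_sub_one h4 _).1 h1
    · obtain ⟨σ, -, h2⟩ := key ⊤ hTop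
      exact ⟨σ, h2, fun _ => four_dvd_sub_one_of_sq_eq_neg_one hk2 hζ σ.1 (hspec σ) hi⟩
  · obtain ⟨σ, -, h2⟩ := key ⊤ hTop
    exact ⟨σ, h2, fun h => absurd h hp2⟩

/-! ### From prime powers to `n` -/

/-- If `γ ^ a = α = δ ^ b` and `x * a + y * b = 1`, then `γ ^ y * δ ^ x` is the root sought. -/
theorem exists_pow_mul_eq_of_coprime {K : Type*} [Field K] {a b : ℕ} (hab : a.Coprime b) {α : K}
    (hα : α ≠ 0) (ha : ∃ γ : K, γ ^ a = α) (hb : ∃ γ : K, γ ^ b = α) :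
    ∃ γ : K, γ ^ (a * b) = α := by
  obtain ⟨γ, hγ⟩ := ha
  obtain ⟨δ, hδ⟩ := hb
  obtain ⟨x, y, hxy⟩ := Nat.isCoprime_iff_coprime.2 hab
  refine ⟨γ ^ y * δ ^ x, ?_⟩
  have h1 : (γ ^ y) ^ (a * b) = α ^ (y * b) := by
    rw [← hγ, ← zpow_natCast, ← zpow_natCast γ a, ← zpow_mul, ← zpow_mul]
    congr 1
    push_cast
    ring
  have h2 : (δ ^ x) ^ (a * b) = α ^ (x * a) := by
    rw [← hδ, ← zpow_natCast, ← zpow_natCast δ b, ← zpow_mul, ← zpow_mul]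
    congr 1
    push_cast
    ring
  rw [mul_pow, h1, h2, ← zpow_add₀ hα, add_comm, hxy, zpow_one]

/-- Being an `n`-th power can be checked on the prime powers exactly dividing `n`. -/
theorem exists_pow_eq_of_forall_prime {K : Type*} [Field K] {α : K} (hα : α ≠ 0) {n : ℕ}
    (hn : n ≠ 0) (h : ∀ p : ℕ, p.Prime → ∃ γ : K, γ ^ p ^ n.factorization p = α) :
    ∃ γ : K, γ ^ n = α := by
  induction n using Nat.recOnPosPrimePosCoprime with
  | prime_pow p j hp hj =>
    simpa [hp.factorization_pow] using h p hp
  | zero => exact absurd rfl hn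
  | one => exact ⟨α, pow_one α⟩
  | coprime a b ha hb hab iha ihb =>
    refine exists_pow_mul_eq_of_coprime hab hα (iha (by lia) fun p hp => ?_)
      (ihb (by lia) fun p hp => ?_) <;>
    · obtain ⟨γ, hγ⟩ := h p hp
      rw [Nat.factorization_mul (by lia) (by lia), Finsupp.add_apply, pow_add] at hγ
      first
        | exact ⟨_, (pow_mul γ _ _).symm.trans hγ⟩
        | exact ⟨_, (pow_mul' γ _ _).symm.trans hγ⟩

/-- Joins the inertia element to the descent, applied to `β ^ m`. The cyclotomic character is
injective, so the group is abelian; and as `σ` fixes `ζ_m`, a power of `σ` fixing `ζ_{p^k}` is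
trivial. -/
theorem exists_pow_prime_pow_eq_of_cyclotomic (K L : Type*) [Field K] [NumberField K] [Field L]
    [NumberField L] [Algebra K L] {p k m v c : ℕ} [NeZero (p ^ k * m)]
    [IsCyclotomicExtension {p ^ k * m} K L] (hp : p.Prime) (hpm : p.Coprime m) (hvk : v < k)
    {μ : L} (hμ : IsPrimitiveRoot μ (p ^ k * m))
    (hc : ∀ e, e ≠ 0 → p ^ (e - 1) ∣ (discr K).natAbs → e * c < (p ^ (v + 1)).totient)
    (hc0 : c ≠ 0) (hI : p = 2 → c = 2 ∨ ∃ i : K, i ^ 2 = -1) {α : K} {β : L}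
    (hβ : β ^ (p ^ k * m) = algebraMap K L α) : ∃ γ : K, γ ^ p ^ (k - v) = α := by
  have hN : 0 < p ^ k * m := Nat.pos_of_ne_zero (NeZero.ne _)
  have hgal : IsGalois K L := IsCyclotomicExtension.isGalois {p ^ k * m} K L
  have hfin : FiniteDimensional K L := IsCyclotomicExtension.finiteDimensional {p ^ k * m} K L
  have hζ : IsPrimitiveRoot (μ ^ m) (p ^ k) := hμ.pow hN (mul_comm _ _)
  have hξ : IsPrimitiveRoot (μ ^ p ^ k) m := hμ.pow hN rfl
  obtain ⟨σ, hσξ, a, hσζ, hav, h4⟩ :=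
    exists_mem_inertia_not_dvd_sub_one K L hp hpm hvk hζ hξ hc hc0 hI
  refine exists_pow_prime_pow_sub_eq_of_central hp hvk.le hζ σ (fun τ => ?_) (a := a)
    (by rw [hσζ, zpow_natCast]) hav h4 (fun r hr => ?_) (β := β ^ m)
    (by rw [← pow_mul, mul_comm, hβ])
  · apply hμ.autToPow_injective K
    rw [map_mul, map_mul]
    exact mul_comm (hμ.autToPow K σ) _
  · have hr' : (σ ^ r) (μ ^ p ^ k) = μ ^ p ^ k := by
      clear hr
      induction r with
      | zero => simp
      | succ r ih => rw [pow_succ, AlgEquiv.mul_apply, hσξ, ih]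
    refine hμ.algEquiv_eq_one_of_apply_eq ?_
    obtain ⟨x, y, hxy⟩ := Nat.isCoprime_iff_coprime.2 (hpm.pow_left k)
    have hμ' : μ = (μ ^ m) ^ y * (μ ^ p ^ k) ^ x := by
      have h0 := hμ.ne_zero hN.ne'
      rw [← zpow_natCast, ← zpow_natCast μ (p ^ k), ← zpow_mul, ← zpow_mul, ← zpow_add₀ h0]
      conv_lhs => rw [← zpow_one μ, ← hxy]
      congr 1
      ring
    rw [hμ', map_mul, map_zpow₀, map_zpow₀, hr, hr']

/-- A sufficient local condition, at each prime, for a constant to be a Chevalley–Bass constant. -/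
theorem chevalleyBassHoldsWith_of_forall_prime (K : Type*) [Field K] [NumberField K] {Λ : ℕ}
    (hΛ : Λ ≠ 0) (h : ∀ p : ℕ, p.Prime → ∃ c ≠ 0, (p = 2 → c = 2 ∨ ∃ i : K, i ^ 2 = -1) ∧
      ∀ e, e ≠ 0 → p ^ (e - 1) ∣ (discr K).natAbs →
        e * c < (p ^ (Λ.factorization p + 1)).totient) :
    ChevalleyBassHoldsWith K Λ := by
  refine ⟨Nat.pos_of_ne_zero hΛ, fun n hn ζ hζ α ⟨β, hβL, hβ⟩ => ?_⟩
  have hN : Λ * n ≠ 0 := mul_ne_zero hΛ hn.ne'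
  rcases eq_or_ne α 0 with rfl | hα
  · exact ⟨0, zero_pow hn.ne'⟩
  refine exists_pow_eq_of_forall_prime hα hn.ne' fun p hp => ?_
  -- For `p ∤ n` nothing is asked; otherwise `v < k`, as the search for `σ` requires.
  rcases Nat.eq_zero_or_pos (n.factorization p) with h0 | hj
  · exact ⟨α, by rw [h0, pow_zero, pow_one]⟩
  obtain ⟨c, hc0, hI, hc⟩ := h p hp
  set L := IntermediateField.adjoin K {ζ} with hL
  have hfac : (Λ * n).factorization p = Λ.factorization p + n.factorization p := by
    rw [Nat.factorization_mul hΛ hn.ne', Finsupp.add_apply]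
  have hsplit : p ^ (Λ * n).factorization p * (Λ * n / p ^ (Λ * n).factorization p) = Λ * n :=
    Nat.ordProj_mul_ordCompl_eq_self _ _
  have hcop := Nat.coprime_ordCompl hp hN
  set m := Λ * n / p ^ (Λ * n).factorization p with hm
  have hne : NeZero (Λ * n) := ⟨hN⟩
  have hne' : NeZero (p ^ (Λ * n).factorization p * m) := ⟨by rwa [hsplit]⟩
  have hcyc : IsCyclotomicExtension {Λ * n} K L :=
    hζ.intermediateField_adjoin_isCyclotomicExtension K
  have hcyc' : IsCyclotomicExtension {p ^ (Λ * n).factorization p * m} K L := by rwa [hsplit]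
  have hfin : FiniteDimensional K L := IsCyclotomicExtension.finiteDimensional {Λ * n} K L
  have hnf : NumberField L := NumberField.of_module_finite K L
  have hμ : IsPrimitiveRoot (⟨ζ, IntermediateField.mem_adjoin_simple_self K ζ⟩ : L)
      (p ^ (Λ * n).factorization p * m) := by
    rw [hsplit]
    exact IsPrimitiveRoot.of_map_of_injective (f := L.val) hζ L.val.injective
  have := exists_pow_prime_pow_eq_of_cyclotomic K L hp hcop (v := Λ.factorization p) (by lia) hμ
    hc hc0 hI (α := α) (β := ⟨β, hβL⟩) (Subtype.ext (by rw [hsplit]; exact hβ))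
  rwa [hfac, Nat.add_sub_cancel_left] at this

/-! ### The numerical constants -/

theorem add_one_lt_totient_prime_pow_succ {p : ℕ} (hp : p.Prime) (hp2 : p ≠ 2) (v : ℕ) :
    v + 1 < (p ^ (v + 1)).totient := by
  have hp3 : 3 ≤ p := by have := hp.two_le; lia
  rw [Nat.totient_prime_pow_succ hp]
  calc v + 1 < 2 ^ v * 2 := by have := Nat.lt_two_pow_self (n := v); lia
    _ ≤ p ^ v * (p - 1) := Nat.mul_le_mul (Nat.pow_le_pow_left (by lia) v) (by lia)

theorem proposition6p2 (K : Type*) [Field K] [NumberField K] :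
    ChevalleyBassHoldsWith K (64 * (NumberField.discr K).natAbs) ∧
      ((∃ i : K, i ^ 2 = -1) →
        ChevalleyBassHoldsWith K (2 * (NumberField.discr K).natAbs)) := by
  have hD : (discr K).natAbs ≠ 0 := Int.natAbs_ne_zero.2 (discr_ne_zero K)
  have hodd : ∀ (a p : ℕ), a ≠ 0 → p.Prime → p ≠ 2 → ∀ e, e ≠ 0 →
      p ^ (e - 1) ∣ (discr K).natAbs →
      e * 1 < (p ^ ((a * (discr K).natAbs).factorization p + 1)).totient := by
    intro a p ha hp hp2 e he hdvd
    have := (hp.pow_dvd_iff_le_factorization (mul_ne_zero ha hD)).1 (hdvd.mul_left a)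
    have := add_one_lt_totient_prime_pow_succ hp hp2 ((a * (discr K).natAbs).factorization p)
    lia
  refine ⟨chevalleyBassHoldsWith_of_forall_prime K (by positivity) fun p hp => ?_, fun hi =>
    chevalleyBassHoldsWith_of_forall_prime K (by positivity) fun p hp => ?_⟩ <;>
  rcases eq_or_ne p 2 with rfl | hp2
  · refine ⟨2, two_ne_zero, fun _ => .inl rfl, fun e he hdvd => ?_⟩
    have h1 : 2 ^ (6 + (e - 1)) ∣ 64 * (discr K).natAbs := by
      rw [pow_add]
      exact mul_dvd_mul_left _ hdvd
    rw [hp.pow_dvd_iff_le_factorization (by positivity)] at h1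
    rw [Nat.totient_prime_pow_succ hp, Nat.add_one_sub_one, mul_one]
    -- The valuation of `64 * |D|` is at least `e + 5`, while `e + 1` suffices here.
    calc e * 2 < 2 ^ e * 2 := Nat.mul_lt_mul_of_pos_right Nat.lt_two_pow_self two_pos
      _ = 2 ^ (e + 1) := (pow_succ _ _).symm
      _ ≤ _ := Nat.pow_le_pow_right two_pos (by lia)
  · exact ⟨1, one_ne_zero, fun h => absurd h hp2, hodd 64 p (by norm_num) hp hp2⟩
  · refine ⟨1, one_ne_zero, fun _ => .inr hi, fun e he hdvd => ?_⟩
    have h1 : 2 ^ (1 + (e - 1)) ∣ 2 * (discr K).natAbs := by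
      rw [pow_add, pow_one]
      exact mul_dvd_mul_left _ hdvd
    rw [hp.pow_dvd_iff_le_factorization (by positivity)] at h1
    rw [Nat.totient_prime_pow_succ hp, Nat.add_one_sub_one, mul_one, mul_one]
    -- With `i ∈ K` no index is lost, so valuation `e` suffices, which the factor `2` provides.
    exact Nat.lt_two_pow_self.trans_le (Nat.pow_le_pow_right two_pos (by lia))
  · exact ⟨1, one_ne_zero, fun h => absurd h hp2, hodd 2 p two_ne_zero hp hp2⟩
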